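/- Let $(R,\mathfrak m)$ be a one-dimensional commutative Noetherian Cohen–Macaulay local ring such that every $\mathfrak m$-primary ideal of $R$ has a principal minimal reduction (for example, $R$ with infinite residue field). Assume that $R$ is not Gorenstein, that $R$ is generically Gorenstein (i.e. $R_{\mathfrak p}$ is Gorenstein for every minimal prime $\mathfrak p$), and that $\omega_R$ is a canonical ideal of $R$, i.e. an ideal of $R$ that is isomorphic to a canonical module of $R$. Let $I$ be an $\mathfrak m$-primary ideal of $R$. For an ideal $J$ of $R$ that is primary to $\mathfrak m$ and a nonzero finitely generated torsion-free $R$-module $M$, let $e_R(J,M)=\lim_{n\to\infty}\frac1n\,\ell_R(M/J^nM)$ be the Hilbert–Samuel multiplicity. One says that $M$ *has minimal multiplicity with respect to $J$* if $e_R(J,M)=\ell_R(JM/J^2M)$, and that $M$ is *$J$-Ulrich* if $e_R(J,M)=\ell_R(M/JM)$. (Under the present assumptions $\omega_R$ is automatically $\mathfrak m$-primary.) Write $I^*=\operatorname{Hom}_R(I,R)$, and call $I$ a *trace ideal* if it is the trace of some finitely generated $R$-module $N$, i.e. $I=\sum_{f\in\operatorname{Hom}_R(N,R)}f(N)$. (i)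 If the $R$-module $I$ has minimal multiplicity with respect to $\omega_R$, then $I^*$ is $\omega_R$-Ulrich. (ii) Suppose that $I$ is a trace ideal. If $I^*$ is $\omega_R$-Ulrich, then $I$ is $\omega_R$-Ulrich. Consequently, for a trace ideal $I$, the $R$-module $I$ has minimal multiplicity with respect to $\omega_R$ if and only if $I$ is $\omega_R$-Ulrich. -/

import Mathlib

open CategoryTheory IsLocalRing Filter Topology

universe u

namespace LocalAlg

/-- A finitely generated module `M` over a Noetherian local ring is maximal Cohen–Macaulay:
there is an `M`-regular sequence in the maximal ideal whose length is the dimension of the ring. -/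
structure IsMaximalCohenMacaulay (R : Type u) [CommRing R] [IsLocalRing R]
    (M : Type u) [AddCommGroup M] [Module R M] : Prop where
  finite : Module.Finite R M
  exists_regular : ∃ rs : List R, (∀ r ∈ rs, r ∈ maximalIdeal R) ∧
    RingTheory.Sequence.IsRegular M rs ∧ ((rs.length : ℕ) : WithBot ℕ∞) = ringKrullDim R

/-- Cohen–Macaulay (Noetherian) local rings. -/
def IsCohenMacaulayLocalRing (R : Type u) [CommRing R] [IsLocalRing R] : Prop :=
  IsMaximalCohenMacaulay R R

/-- The module `M` has finite injective dimension over `R`. -/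
def HasFiniteInjectiveDimension (R : Type u) [CommRing R]
    (M : Type u) [AddCommGroup M] [Module R M] : Prop :=
  ∃ n : ℕ, HasInjectiveDimensionLE (ModuleCat.of R M) n

/-- A (Noetherian) local ring is Gorenstein if it has finite injective dimension over itself. -/
def IsGorensteinLocalRing (R : Type u) [CommRing R] [IsLocalRing R] : Prop :=
  HasFiniteInjectiveDimension R R

/-- `R` is generically Gorenstein: its localization at every minimal prime is Gorenstein. -/
def IsGenericallyGorenstein (R : Type u) [CommRing R] : Prop :=
  ∀ (p : Ideal R) [p.IsPrime], p ∈ minimalPrimes R → IsGorensteinLocalRing (Localization.AtPrime p)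

/-- A canonical module of a Cohen–Macaulay local ring `R` of dimension `d` with residue field `k`:
a maximal Cohen–Macaulay module `C` of finite injective dimension and of type one, that is,
`Ext^d_R(k, C) ≅ k`. -/
structure IsCanonicalModule (R : Type u) [CommRing R] [IsLocalRing R]
    (C : Type u) [AddCommGroup C] [Module R C] : Prop where
  maximalCohenMacaulay : IsMaximalCohenMacaulay R C
  finite_injDim : HasFiniteInjectiveDimension R C
  type_one : ∃ d : ℕ, ringKrullDim R = (d : WithBot ℕ∞) ∧
    Nonempty (Abelian.Ext (ModuleCat.of R (ResidueField R)) (ModuleCat.of R C) d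
      ≃ₗ[R] ResidueField R)

/-- A canonical ideal: an ideal which, as a module, is a canonical module. -/
def IsCanonicalIdeal {R : Type u} [CommRing R] [IsLocalRing R] (ω : Ideal R) : Prop :=
  IsCanonicalModule R ω

/-- `I` is primary to the maximal ideal. -/
def IsMaximalPrimary {R : Type u} [CommRing R] [IsLocalRing R] (I : Ideal R) : Prop :=
  I.IsPrimary ∧ I.radical = maximalIdeal R

/-- `J` is a reduction of `I`. -/
def IsReduction {R : Type u} [CommRing R] (J I : Ideal R) : Prop :=
  J ≤ I ∧ ∃ n : ℕ, I ^ (n + 1) = J * I ^ n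

/-- `J` is a reduction of `I` that is minimal with respect to inclusion. -/
def IsMinimalReduction {R : Type u} [CommRing R] (J I : Ideal R) : Prop :=
  Minimal (fun J' : Ideal R => IsReduction J' I) J

/-- `e` is the Hilbert–Samuel multiplicity of the `d`-dimensional module `M` with respect to `I`:
the limit of `d! · ℓ(M / IⁿM) / nᵈ`. -/
def IsHilbertSamuelMultiplicity {R : Type u} [CommRing R] (d : ℕ) (I : Ideal R)
    (M : Type u) [AddCommGroup M] [Module R M] (e : ℕ∞) : Prop :=
  Tendsto (fun n : ℕ => (d.factorial : ENNReal) *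
    (Module.length R (M ⧸ (I ^ n • ⊤ : Submodule R M)) : ENNReal) / (n : ENNReal) ^ d)
    atTop (𝓝 (e : ENNReal))

/-- For a one-dimensional Cohen–Macaulay local ring `R` and an ideal `I` primary to the maximal
ideal: the nonzero finitely generated torsion-free module `M` has minimal multiplicity with respect
to `I`, that is, `e(I, M) = ℓ(IM / I²M)`. (Such a module has dimension one.) -/
structure HasMinimalMultiplicity {R : Type u} [CommRing R] (I : Ideal R)
    (M : Type u) [AddCommGroup M] [Module R M] : Prop where
  finite : Module.Finite R M
  nontrivial : Nontrivial M
  torsionFree : Module.IsTorsionFree R M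
  multiplicity_eq : IsHilbertSamuelMultiplicity 1 I M
    (Module.length R (↥(I • ⊤ : Submodule R M) ⧸
      (I ^ 2 • ⊤ : Submodule R M).submoduleOf (I • ⊤ : Submodule R M)))

/-- For a one-dimensional Cohen–Macaulay local ring `R` and an ideal `I` primary to the maximal
ideal: the nonzero finitely generated torsion-free module `M` is `I`-Ulrich, that is,
`e(I, M) = ℓ(M / IM)`. -/
structure IsUlrich {R : Type u} [CommRing R] (I : Ideal R)
    (M : Type u) [AddCommGroup M] [Module R M] : Prop where
  finite : Module.Finite R M
  nontrivial : Nontrivial M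
  torsionFree : Module.IsTorsionFree R M
  multiplicity_eq : IsHilbertSamuelMultiplicity 1 I M
    (Module.length R (M ⧸ (I • ⊤ : Submodule R M)))

/-- The trace ideal of a module: the sum of the images of all linear forms on it. -/
def trace (R : Type u) [CommRing R] (M : Type u) [AddCommGroup M] [Module R M] : Ideal R :=
  ⨆ f : Module.Dual R M, LinearMap.range f

/-- `I` is a trace ideal: it is the trace of some finitely generated module. -/
def IsTraceIdeal {R : Type u} [CommRing R] (I : Ideal R) : Prop :=
  ∃ (M : Type u) (_ : AddCommGroup M) (_ : Module R M), Module.Finite R M ∧ I = trace R M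

end LocalAlg

/-! Choose a nonzerodivisor `a ∈ ω` with `ω ^ (n + 1) = a ω ^ n`. For finitely generated
torsion-free `M` the multiplicity is then `ℓ(M/aM)`, so length conditions become equalities of
submodules: `M` is Ulrich iff `ωM = aM` (`isUlrich_iff`), and has minimal multiplicity iff `ω²M =
aωM` (`hasMinimalMultiplicity_iff`).

For (i), take `f ∈ I*`, `w ∈ ω`, `i ∈ I`. Then `w f(i) ω ⊆ f(ω²I) = a f(ωI) ⊆ aω`, so `w f(i)/a` is
an endomorphism of `ω`. Since `End(ω) = R`, the form `wf` is `a` times an element of `I*`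
(`ideal_smul_dual_eq`). For (ii), dividing `w` times the inclusion `I → R` by `a` gives a form on
`I`; it maps `I` into `I` because `I` is a trace ideal, so `wI ⊆ aI` (`IsTraceIdeal.ideal_smul_eq`).
Finally `ωI = aI` gives `ω²I = aωI`.

The substantial input is `End(ω) = R` (`IsCanonicalIdeal.faithful_and_endomorphism`), derived from
finite injective dimension and type one. For a regular `x ∈ 𝔪` put `E = ω/xω`. Vanishing of `Ext²(-,
ω)` on finite length modules makes `E` injective relative to modules killed by `x`, and its socle
has length at most one. Hence `E` is faithful over `R/x`, a length count gives `R/x = End(E)`, and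
Nakayama lifts this to `ω`. -/

namespace LocalAlg

/-! ### Vanishing of `Ext²` from finite length modules -/

section ExtVanishing

open Abelian

variable {R : Type u} [CommRing R]

/-- The short complex `N → M → M ⧸ N`. -/
abbrev submoduleShortComplex {M : Type u} [AddCommGroup M] [Module R M] (N : Submodule R M) :
    ShortComplex (ModuleCat.{u} R) :=
  ModuleCat.shortComplexOfCompEqZero N.subtype N.mkQ
    (LinearMap.exact_subtype_mkQ N).linearMap_comp_eq_zero

theorem submoduleShortComplex_shortExact {M : Type u} [AddCommGroup M] [Module R M]
    (N : Submodule R M) : (submoduleShortComplex N).ShortExact where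
  exact := ModuleCat.shortComplex_exact _ (LinearMap.exact_subtype_mkQ N)
  mono_f := (ModuleCat.mono_iff_injective _).mpr N.injective_subtype
  epi_g := (ModuleCat.epi_iff_surjective _).mpr N.mkQ_surjective

theorem Ext.subsingleton_of_submodule_of_quotient (W : ModuleCat.{u} R) (n : ℕ)
    {M : Type u} [AddCommGroup M] [Module R M] (N : Submodule R M)
    (h₁ : Subsingleton (Ext (ModuleCat.of R N) W n))
    (h₂ : Subsingleton (Ext (ModuleCat.of R (M ⧸ N)) W n)) :
    Subsingleton (Ext (ModuleCat.of R M) W n) := by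
  refine subsingleton_of_forall_eq 0 fun e => ?_
  obtain ⟨f, hf⟩ := Ext.contravariant_sequence_exact₂ (submoduleShortComplex_shortExact N) W e
    (h₁.elim _ _)
  rw [← hf, h₂.elim f 0, Ext.comp_zero]

theorem Ext.subsingleton_of_linearEquiv (W : ModuleCat.{u} R) (n : ℕ)
    {M N : Type u} [AddCommGroup M] [Module R M] [AddCommGroup N] [Module R N] (e : M ≃ₗ[R] N)
    (h : Subsingleton (Ext (ModuleCat.of R N) W n)) :
    Subsingleton (Ext (ModuleCat.of R M) W n) := by
  refine subsingleton_of_forall_eq 0 fun f => ?_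
  have h1 : f = (Ext.mk₀ e.toModuleIso.hom).comp
      ((Ext.mk₀ e.toModuleIso.inv).comp f (zero_add n)) (zero_add n) := by
    rw [Ext.mk₀_comp_mk₀_assoc, Iso.hom_inv_id, Ext.mk₀_id_comp]
  rw [h1, h.elim ((Ext.mk₀ e.toModuleIso.inv).comp f (zero_add n)) 0, Ext.comp_zero]

theorem nonempty_linearEquiv_residueField [IsLocalRing R] (S : Type u) [AddCommGroup S]
    [Module R S] [IsSimpleModule R S] : Nonempty (S ≃ₗ[R] ResidueField R) := by
  obtain ⟨J, hJ, ⟨e⟩⟩ := (isSimpleModule_iff_quot_maximal (R := R) (M := S)).1 inferInstance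
  obtain rfl := IsLocalRing.eq_maximalIdeal hJ
  exact ⟨e⟩

theorem Ext.subsingleton_of_isFiniteLength [IsLocalRing R] (W : ModuleCat.{u} R) (n : ℕ)
    (h : Subsingleton (Ext (ModuleCat.of R (ResidueField R)) W n))
    {M : Type u} [AddCommGroup M] [Module R M] (hM : IsFiniteLength R M) :
    Subsingleton (Ext (ModuleCat.of R M) W n) := by
  induction hM with
  | @of_subsingleton M _ _ _ =>
    refine subsingleton_of_forall_eq 0 fun e => ?_
    rw [← Ext.mk₀_id_comp e, (ModuleCat.isZero_of_subsingleton (ModuleCat.of R M)).eq_of_src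
      (𝟙 _) 0, Ext.mk₀_zero, Ext.zero_comp]
  | @of_simple_quotient M _ _ N _ _ ih =>
    obtain ⟨e⟩ := nonempty_linearEquiv_residueField (R := R) (M ⧸ N)
    exact Ext.subsingleton_of_submodule_of_quotient W n N ih
      (Ext.subsingleton_of_linearEquiv W n e h)

/-- The resolution `0 → R → R → R/x → 0` shows that `R/x` has projective dimension at most one. -/
theorem Ext.subsingleton_quotSMulTop (W : ModuleCat.{u} R) {x : R} (hx : IsSMulRegular R x)
    (n : ℕ) : Subsingleton (Ext (ModuleCat.of R (QuotSMulTop x R)) W (n + 2)) := by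
  refine subsingleton_of_forall_eq 0 fun e => ?_
  have : Projective (ModuleCat.of R R) := inferInstance
  obtain ⟨f, hf⟩ := Ext.contravariant_sequence_exact₃
    (IsSMulRegular.smulShortComplex_shortExact (M := ModuleCat.of R R) hx) W e
    (n₀ := n + 1) (Ext.eq_zero_of_projective (P := ModuleCat.of R R) _) (by omega)
  have hf0 : f = 0 := Ext.eq_zero_of_projective (P := ModuleCat.of R R) f
  rw [← hf, hf0]
  exact Ext.comp_zero ..

theorem quotSMulTop_isFiniteLength_of_span {x : R} (h : IsFiniteLength R (R ⧸ Ideal.span {x})) :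
    IsFiniteLength R (QuotSMulTop x R) := by
  refine (Submodule.quotEquivOfEq _ _ ?_).isFiniteLength h
  ext y
  simp [Ideal.mem_span_singleton', Submodule.mem_smul_pointwise_iff_exists, mul_comm]

theorem exists_residueField_submodule [IsLocalRing R] (M : Type u) [AddCommGroup M] [Module R M]
    [Nontrivial M] (hM : IsFiniteLength R M) :
    ∃ N : Submodule R M, Nonempty (N ≃ₗ[R] ResidueField R) := by
  have := (isFiniteLength_iff_isNoetherian_isArtinian.1 hM).2
  have : IsAtomic (Submodule R M) := isAtomic_of_orderBot_wellFounded_lt wellFounded_lt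
  obtain ⟨N, hN⟩ := IsAtomic.exists_atom (Submodule R M)
  have := isSimpleModule_iff_isAtom.2 hN
  exact ⟨N, nonempty_linearEquiv_residueField N⟩

/-- If `x` is a nonzerodivisor in the maximal ideal with `R ⧸ x` of finite length, and `W` has
finite injective dimension, then `Ext²(M, W) = 0` for `M` of finite length. -/
theorem Ext.subsingleton_two_of_isFiniteLength [IsLocalRing R] {W : Type u} [AddCommGroup W]
    [Module R W] (hW : HasFiniteInjectiveDimension R W) {x : R} (hxm : x ∈ maximalIdeal R)
    (hx : IsSMulRegular R x) (hfl : IsFiniteLength R (QuotSMulTop x R))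
    {M : Type u} [AddCommGroup M] [Module R M] (hM : IsFiniteLength R M) :
    Subsingleton (Ext (ModuleCat.of R M) (ModuleCat.of R W) 2) := by
  obtain ⟨n, hn⟩ := hW
  have hnt : Nontrivial (QuotSMulTop x R) := nontrivial_quotSMulTop_of_mem_maximalIdeal R hxm
  obtain ⟨N, ⟨e⟩⟩ := exists_residueField_submodule _ hfl
  -- Descending induction on the degree, with `j` bounding the distance to the range killed by
  -- finite injective dimension. Embed `k` as `N` in `R/x`: then `Ext^(i+2)(k, W)` sits between
  -- `Ext^(i+2)(R/x, W) = 0` and `Ext^(i+3)((R/x)/N, W)`, which vanishes by induction.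
  have key : ∀ j : ℕ, ∀ i : ℕ, n + 1 ≤ i + j → Subsingleton
      (Ext (ModuleCat.of R (ResidueField R)) (ModuleCat.of R W) (i + 2)) := by
    intro j
    induction j with
    | zero => exact fun i hi => HasInjectiveDimensionLT.subsingleton _ (n + 1) _ (by omega) _
    | succ j ih =>
      intro i hi
      refine Ext.subsingleton_of_linearEquiv _ _ e.symm ?_
      refine subsingleton_of_forall_eq 0 fun f => ?_
      have h3 : Subsingleton (Ext (ModuleCat.of R (QuotSMulTop x R ⧸ N)) (ModuleCat.of R W)
          (i + 3)) := Ext.subsingleton_of_isFiniteLength _ _ (ih (i + 1) (by omega))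
            (hfl.of_surjective N.mkQ_surjective)
      obtain ⟨g, rfl⟩ := Ext.contravariant_sequence_exact₁ (submoduleShortComplex_shortExact N)
        (ModuleCat.of R W) f (n₁ := i + 3) (by omega) (h3.elim _ _)
      rw [(Ext.subsingleton_quotSMulTop (ModuleCat.of R W) hx i).elim g 0, Ext.comp_zero]
  exact Ext.subsingleton_of_isFiniteLength _ _ (key (n + 1) 0 (by omega)) hM

end ExtVanishing

/-! ### The reduction `W/xW`: extension of maps and length of its duals -/

section Socle

open Abelian

variable {R : Type u} [CommRing R] {W : Type u} [AddCommGroup W] [Module R W] {x : R}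
  (hW : IsSMulRegular W x) {M : Type u} [AddCommGroup M] [Module R M]

/-- The connecting map `Hom(M, W ⧸ xW) → Ext¹(M, W)`. -/
noncomputable def homQuotToExt (hW : IsSMulRegular W x) (M : Type u) [AddCommGroup M]
    [Module R M] : (M →ₗ[R] QuotSMulTop x W) →ₗ[R] Ext (ModuleCat.of R M) (ModuleCat.of R W) 1 where
  toFun f := (Ext.mk₀ (ModuleCat.ofHom f)).comp
    (IsSMulRegular.smulShortComplex_shortExact (M := ModuleCat.of R W) hW).extClass (zero_add 1)
  map_add' f g := by
    rw [ModuleCat.ofHom_add, Ext.mk₀_add]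
    exact Ext.add_comp ..
  map_smul' r f := by
    have : ModuleCat.ofHom (r • f) = r • ModuleCat.ofHom f := rfl
    rw [this, Ext.mk₀_smul]
    exact Ext.smul_comp ..

/-- The kernel comes from `Hom(M, W)`, which is zero because `x` kills `M` and is regular on `W`. -/
theorem homQuotToExt_injective (hM : ∀ m : M, x • m = 0) :
    Function.Injective (homQuotToExt hW M) := by
  rw [injective_iff_map_eq_zero]
  intro f hf
  obtain ⟨t, ht⟩ := Ext.covariant_sequence_exact₃ (ModuleCat.of R M)
    (IsSMulRegular.smulShortComplex_shortExact (M := ModuleCat.of R W) hW)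
    (Ext.mk₀ (ModuleCat.ofHom f)) (n₁ := 1) rfl hf
  obtain ⟨t, rfl⟩ := Ext.mk₀_bijective _ _ |>.2 t
  have h0 : t = 0 := by
    ext m
    refine hW ?_
    change x • t.hom m = x • 0
    rw [← map_smul, hM, map_zero, smul_zero]
  rw [h0, Ext.mk₀_zero, Ext.zero_comp] at ht
  have := (Ext.mk₀_eq_zero_iff _).1 ht.symm
  exact congrArg ModuleCat.Hom.hom this

/-- Multiplication by `x` on `Ext¹(M, W)` can be computed on `M`, where it is zero, so every class
lifts along the connecting map. -/
theorem exists_homQuotToExt_eq (hM : ∀ m : M, x • m = 0)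
    (e : Ext (ModuleCat.of R M) (ModuleCat.of R W) 1) :
    ∃ f : M →ₗ[R] QuotSMulTop x W, homQuotToExt hW M f = e := by
  have h0 : x • 𝟙 (ModuleCat.of R M) = 0 := by
    ext m
    exact hM m
  have hx : e.comp (Ext.mk₀ (x • 𝟙 (ModuleCat.of R W))) (add_zero 1) = 0 := by
    rw [Ext.mk₀_smul, Ext.comp_smul, Ext.comp_mk₀_id, ← Ext.mk₀_id_comp e, ← Ext.smul_comp,
      ← Ext.mk₀_smul, h0, Ext.mk₀_zero, Ext.zero_comp]
  obtain ⟨f, hf⟩ := Ext.covariant_sequence_exact₁ (ModuleCat.of R M)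
    (IsSMulRegular.smulShortComplex_shortExact (M := ModuleCat.of R W) hW) e hx (n₀ := 0) rfl
  obtain ⟨f, rfl⟩ := Ext.mk₀_bijective _ _ |>.2 f
  exact ⟨f.hom, hf⟩

include hW in
/-- Maps into `W ⧸ xW` extend along inclusions `N ≤ M` when `xM = 0` and `Ext²(M ⧸ N, W) = 0`. -/
theorem exists_extension_to_quotSMulTop (hM : ∀ m : M, x • m = 0) (N : Submodule R M)
    (hN : Subsingleton (Ext (ModuleCat.of R (M ⧸ N)) (ModuleCat.of R W) 2))
    (f : N →ₗ[R] QuotSMulTop x W) : ∃ g : M →ₗ[R] QuotSMulTop x W, g ∘ₗ N.subtype = f := by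
  -- The problem is moved to `Ext¹(-, W)`, where restriction from `M` to `N` is surjective since
  -- `Ext²(M ⧸ N, W) = 0`.
  obtain ⟨e, he⟩ := Ext.contravariant_sequence_exact₁ (submoduleShortComplex_shortExact N)
    (ModuleCat.of R W) (homQuotToExt hW N f) (n₁ := 2) rfl (hN.elim _ _)
  obtain ⟨g, rfl⟩ := exists_homQuotToExt_eq hW hM e
  refine ⟨g, homQuotToExt_injective hW (fun m => Subtype.ext (hM m)) ?_⟩
  rw [← he]
  exact (Ext.mk₀_comp_mk₀_assoc (ModuleCat.ofHom N.subtype) (ModuleCat.ofHom g) _).symm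

include hW in
theorem length_hom_residueField_le_one [IsLocalRing R] (hx : x ∈ maximalIdeal R)
    (h : Nonempty (Ext (ModuleCat.of R (ResidueField R)) (ModuleCat.of R W) 1
      ≃ₗ[R] ResidueField R)) :
    Module.length R (ResidueField R →ₗ[R] QuotSMulTop x W) ≤ 1 := by
  obtain ⟨e⟩ := h
  have hk : ∀ m : ResidueField R, x • m = 0 := by
    intro m
    rw [Algebra.smul_def, ResidueField.algebraMap_eq, (residue_eq_zero_iff x).2 hx, zero_mul]
  have hs : IsSimpleModule R (ResidueField R) :=
    isSimpleModule_iff_quot_maximal.2 ⟨maximalIdeal R, inferInstance, ⟨LinearEquiv.refl _ _⟩⟩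
  rw [← Module.length_eq_one R (ResidueField R)]
  exact Module.length_le_of_injective (e.toLinearMap ∘ₗ homQuotToExt hW _)
    (e.injective.comp (homQuotToExt_injective hW hk))

/-- If `Hom(k, E)` has length at most one, then `ℓ(Hom(M, E)) ≤ ℓ(M)` for all `M` of finite
length. -/
theorem length_hom_le [IsLocalRing R] {E : Type u} [AddCommGroup E] [Module R E]
    (h : Module.length R (ResidueField R →ₗ[R] E) ≤ 1) (hM : IsFiniteLength R M) :
    Module.length R (M →ₗ[R] E) ≤ Module.length R M := by
  induction hM with
  | @of_subsingleton M _ _ _ =>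
    rw [Module.length_eq_zero_iff.2 (inferInstance : Subsingleton (M →ₗ[R] E))]
    exact zero_le
  | @of_simple_quotient M _ _ N _ _ ih =>
    obtain ⟨e⟩ := nonempty_linearEquiv_residueField (R := R) (M ⧸ N)
    have h1 : Module.length R (M ⧸ N →ₗ[R] E) ≤ 1 := by
      rw [(LinearEquiv.congrLeft E R e).length_eq]
      exact h
    let φ : (M →ₗ[R] E) →ₗ[R] (N →ₗ[R] E) := LinearMap.lcomp R E N.subtype
    let ψ : (M ⧸ N →ₗ[R] E) →ₗ[R] (M →ₗ[R] E) := LinearMap.lcomp R E N.mkQ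
    have hψ : Function.Injective ψ := fun f g hfg => by
      ext m
      exact LinearMap.congr_fun hfg m
    have hex : Function.Exact ψ φ.rangeRestrict := by
      intro f
      constructor
      · intro hf
        refine ⟨N.liftQ f fun n hn => ?_, by ext; rfl⟩
        exact LinearMap.congr_fun (congrArg Subtype.val hf) ⟨n, hn⟩
      · rintro ⟨g, rfl⟩
        ext n
        change g (N.mkQ n) = 0
        rw [Submodule.mkQ_apply, (Submodule.Quotient.mk_eq_zero N).2 n.2, map_zero]
    rw [Module.length_eq_add_of_exact ψ φ.rangeRestrict hψ φ.surjective_rangeRestrict hex,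
      Module.length_eq_add_of_exact N.subtype N.mkQ N.injective_subtype N.mkQ_surjective
        (LinearMap.exact_subtype_mkQ N), add_comm, Module.length_eq_one R (M ⧸ N)]
    exact add_le_add ((Module.length_le_of_injective φ.range.subtype
      (Submodule.injective_subtype _)).trans ih) h1

end Socle

/-! ### Faithfulness of `W` and endomorphisms as homotheties -/

section EndomorphismRing

variable {R : Type u} [CommRing R]

theorem isFiniteLength_of_smul_eq_zero [IsNoetherianRing R] {x : R}
    (h : IsFiniteLength R (R ⧸ Ideal.span {x})) (M : Type*) [AddCommGroup M] [Module R M]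
    [Module.Finite R M] (hM : ∀ m : M, x • m = 0) : IsFiniteLength R M := by
  have hA : IsArtinian R (R ⧸ Ideal.span {x}) := (isFiniteLength_iff_isNoetherian_isArtinian.1 h).2
  have hA' : IsArtinianRing (R ⧸ Ideal.span {x}) := isArtinian_of_tower R hA
  have ht : Module.IsTorsionBySet R M (Ideal.span {x} : Ideal R) := by
    rw [Module.isTorsionBySet_span_singleton_iff]
    exact fun {m} => hM m
  let := ht.module
  have : IsScalarTower R (R ⧸ Ideal.span {x}) M := ht.isScalarTower
  have : Module.Finite (R ⧸ Ideal.span {x}) M := Module.Finite.of_restrictScalars_finite R _ M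
  have : IsArtinian (R ⧸ Ideal.span {x}) M := isArtinian_of_fg_of_artinian'
  have : IsArtinian R M := isArtinian_of_surjective_algebraMap (R := R ⧸ Ideal.span {x})
    Ideal.Quotient.mk_surjective
  exact isFiniteLength_iff_isNoetherian_isArtinian.2 ⟨inferInstance, this⟩

theorem surjective_of_injective_of_length_le {M N : Type*} [AddCommGroup M] [Module R M]
    [AddCommGroup N] [Module R N] (hM : Module.length R M ≠ ⊤)
    (h : Module.length R N ≤ Module.length R M) (f : M →ₗ[R] N) (hf : Function.Injective f) :
    Function.Surjective f := by
  have h1 := Module.length_eq_add_of_exact f f.range.mkQ hf (Submodule.mkQ_surjective _)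
    (LinearMap.exact_map_mkQ_range f)
  rw [h1] at h
  have h2 : Module.length R (N ⧸ f.range) = 0 := by
    have h3 : Module.length R M + Module.length R (N ⧸ f.range) ≤ Module.length R M + 0 := by
      simpa using h
    simpa using (ENat.add_le_add_iff_left hM).1 h3
  rw [Module.length_eq_zero_iff, Submodule.Quotient.subsingleton_iff] at h2
  exact LinearMap.range_eq_top.1 h2

/-- A linear map into `xW`, for `x` regular on `W`, is divisible by `x`. -/
theorem exists_smul_eq_of_forall_mem {M W : Type*} [AddCommGroup M] [Module R M]
    [AddCommGroup W] [Module R W] {x : R} (hx : IsSMulRegular W x) (f : M →ₗ[R] W)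
    (hf : ∀ m, ∃ w : W, x • w = f m) : ∃ g : M →ₗ[R] W, x • g = f := by
  choose g hg using hf
  refine ⟨⟨⟨g, fun a b => hx ?_⟩, fun r a => hx ?_⟩, LinearMap.ext hg⟩
  · change x • g (a + b) = x • (g a + g b)
    rw [smul_add, hg, hg, hg, map_add]
  · change x • g (r • a) = x • (r • g a)
    rw [smul_comm, hg, hg, map_smul]

theorem quotSMulTop_mk_eq_zero_iff {W : Type*} [AddCommGroup W] [Module R W] {x : R} {w : W} :
    (Submodule.Quotient.mk w : QuotSMulTop x W) = 0 ↔ ∃ v : W, x • v = w := by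
  rw [Submodule.Quotient.mk_eq_zero, Submodule.mem_smul_pointwise_iff_exists]
  simp

theorem smul_quotSMulTop {W : Type*} [AddCommGroup W] [Module R W] (x : R)
    (m : QuotSMulTop x W) : x • m = 0 := by
  obtain ⟨w, rfl⟩ := Submodule.Quotient.mk_surjective _ m
  rw [← Submodule.Quotient.mk_smul, quotSMulTop_mk_eq_zero_iff]
  exact ⟨w, rfl⟩

variable [IsLocalRing R] [IsNoetherianRing R] {W : Type u} [AddCommGroup W] [Module R W]
  [Module.Finite R W] [Nontrivial W] {x : R} (hxm : x ∈ maximalIdeal R)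
  (hxR : IsSMulRegular R x) (hxW : IsSMulRegular W x)
  (hfl : IsFiniteLength R (R ⧸ Ideal.span {x})) (hinj : HasFiniteInjectiveDimension R W)

include hxm hxR hxW hfl hinj

/-- `W ⧸ xW` is faithful over `R ⧸ x`. -/
theorem exists_eq_mul_of_smul_quotSMulTop_eq_zero {r : R}
    (hr : ∀ e : QuotSMulTop x W, r • e = 0) : ∃ b, x * b = r := by
  have hfA := quotSMulTop_isFiniteLength_of_span hfl
  have hfE := isFiniteLength_of_smul_eq_zero hfl (QuotSMulTop x W) (smul_quotSMulTop x)
  by_contra hcon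
  have hne : (Submodule.Quotient.mk r : QuotSMulTop x R) ≠ 0 := fun h =>
    hcon (quotSMulTop_mk_eq_zero_iff.1 h)
  have := (isFiniteLength_iff_isNoetherian_isArtinian.1 hfA).2
  have : IsAtomic (Submodule R (QuotSMulTop x R)) :=
    isAtomic_of_orderBot_wellFounded_lt wellFounded_lt
  -- If `r` were nonzero in `R/x`, its span would contain a simple `N`. Embed `N` in `W/xW` and
  -- extend to `g` on `R/x`: elements of `N` are multiples of `r`, so `g` kills `N`, a
  -- contradiction.
  obtain h | ⟨N, hN, hNr⟩ := eq_bot_or_exists_atom_le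
    (Submodule.span R {(Submodule.Quotient.mk r : QuotSMulTop x R)})
  · exact hne (Submodule.span_singleton_eq_bot.1 h)
  have := isSimpleModule_iff_isAtom.2 hN
  obtain ⟨e₁⟩ := nonempty_linearEquiv_residueField (R := R) N
  have := nontrivial_quotSMulTop_of_mem_maximalIdeal W hxm
  obtain ⟨S, ⟨e₂⟩⟩ := exists_residueField_submodule (QuotSMulTop x W) hfE
  obtain ⟨g, hg⟩ := exists_extension_to_quotSMulTop hxW (smul_quotSMulTop x) N
    (Ext.subsingleton_two_of_isFiniteLength hinj hxm hxR hfA (hfA.of_surjective N.mkQ_surjective))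
    (S.subtype ∘ₗ (e₁.trans e₂.symm).toLinearMap)
  have := IsSimpleModule.nontrivial R N
  obtain ⟨n, hn⟩ := exists_ne (0 : N)
  obtain ⟨s, hs⟩ := Submodule.mem_span_singleton.1 (hNr n.2)
  have h1 : g n = 0 := by
    have h2 : (Submodule.Quotient.mk r : QuotSMulTop x R) = r • Submodule.Quotient.mk 1 := by
      rw [← Submodule.Quotient.mk_smul, smul_eq_mul, mul_one]
    rw [← hs, h2, map_smul, map_smul, hr, smul_zero]
  have h2 : S.subtype ((e₁.trans e₂.symm) n) = 0 := by
    rw [← h1]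
    exact (LinearMap.congr_fun hg n).symm
  refine hn ((e₁.trans e₂.symm).injective (Subtype.ext ?_))
  rw [map_zero]
  exact h2

/-- An element of the annihilator kills `W/xW`, hence equals `x b`, and `b` again annihilates `W` by
regularity. Nakayama then makes the annihilator zero. -/
theorem eq_zero_of_forall_smul_eq_zero {r : R} (hr : ∀ w : W, r • w = 0) : r = 0 := by
  have h : Module.annihilator R W ≤ maximalIdeal R • Module.annihilator R W := by
    intro s hs
    rw [Module.mem_annihilator] at hs
    obtain ⟨b, rfl⟩ := exists_eq_mul_of_smul_quotSMulTop_eq_zero hxm hxR hxW hfl hinj (r := s)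
      (fun e => by
        obtain ⟨w, rfl⟩ := Submodule.Quotient.mk_surjective _ e
        rw [← Submodule.Quotient.mk_smul, hs, Submodule.Quotient.mk_zero])
    refine Submodule.smul_mem_smul hxm (Module.mem_annihilator.2 fun w => hxW ?_)
    change x • b • w = x • 0
    rw [← mul_smul, hs, smul_zero]
  have h0 := Submodule.eq_bot_of_le_smul_of_le_jacobson_bot _ _ (IsNoetherian.noetherian _) h
    (maximalIdeal_le_jacobson _)
  simpa [h0] using Module.mem_annihilator.2 hr

/-- Under a socle bound, every endomorphism of `W` is multiplication by a ring element. -/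
theorem exists_forall_apply_eq_smul
    (hsoc : Module.length R (ResidueField R →ₗ[R] QuotSMulTop x W) ≤ 1) (φ : W →ₗ[R] W) :
    ∃ r : R, ∀ w, φ w = r • w := by
  have hfA := quotSMulTop_isFiniteLength_of_span hfl
  have hfE := isFiniteLength_of_smul_eq_zero hfl (QuotSMulTop x W) (smul_quotSMulTop x)
  let j : QuotSMulTop x R →ₗ[R] (QuotSMulTop x W →ₗ[R] QuotSMulTop x W) :=
    Submodule.liftQ _ (LinearMap.lsmul R (QuotSMulTop x W)) (by
      intro r hr
      obtain ⟨b, rfl⟩ := quotSMulTop_mk_eq_zero_iff.1 ((Submodule.Quotient.mk_eq_zero _).2 hr)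
      refine LinearMap.ext fun e => ?_
      change (x • b) • e = 0
      rw [smul_assoc, smul_quotSMulTop])
  have hj : Function.Injective j := by
    rw [injective_iff_map_eq_zero]
    intro a ha
    obtain ⟨r, rfl⟩ := Submodule.Quotient.mk_surjective _ a
    exact quotSMulTop_mk_eq_zero_iff.2 (exists_eq_mul_of_smul_quotSMulTop_eq_zero hxm hxR hxW
      hfl hinj fun e => LinearMap.congr_fun ha e)
  -- Evaluation at `1` maps `Hom(R/x, W/xW)` onto `W/xW`.
  have hE : Module.length R (QuotSMulTop x W) ≤ Module.length R (QuotSMulTop x R) := by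
    refine le_trans (Module.length_le_of_surjective
      (LinearMap.applyₗ (Submodule.Quotient.mk 1 : QuotSMulTop x R) :
        (QuotSMulTop x R →ₗ[R] QuotSMulTop x W) →ₗ[R] _) fun e => ?_) (length_hom_le hsoc hfA)
    refine ⟨Submodule.liftQ _ (LinearMap.toSpanSingleton R _ e) ?_, ?_⟩
    · intro r hr
      obtain ⟨b, rfl⟩ := quotSMulTop_mk_eq_zero_iff.1 ((Submodule.Quotient.mk_eq_zero _).2 hr)
      change (x • b) • e = 0
      rw [smul_assoc, smul_quotSMulTop]
    · exact one_smul R e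
  -- With `E = W/xW`, `ℓ(End E) ≤ ℓ(E) ≤ ℓ(R/x)`, so the injection `R/x → End E` is onto.
  have hsurj := surjective_of_injective_of_length_le (Module.length_ne_top_iff.2 hfA)
    ((length_hom_le hsoc hfE).trans hE) j hj
  -- Modulo `x`, an endomorphism of `W` is some homothety `r`; the difference maps into `xW` and is
  -- therefore `x` times an endomorphism. Nakayama applies to `End(W)`.
  have hle : (⊤ : Submodule R (W →ₗ[R] W)) ≤
      Submodule.span R {LinearMap.id} ⊔ maximalIdeal R • ⊤ := by
    intro f _
    let fbar : QuotSMulTop x W →ₗ[R] QuotSMulTop x W := Submodule.mapQ _ _ f (by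
      intro w hw
      obtain ⟨v, rfl⟩ := quotSMulTop_mk_eq_zero_iff.1 ((Submodule.Quotient.mk_eq_zero _).2 hw)
      rw [Submodule.mem_comap, map_smul, ← Submodule.Quotient.mk_eq_zero]
      exact quotSMulTop_mk_eq_zero_iff.2 ⟨f v, rfl⟩)
    obtain ⟨a, ha⟩ := hsurj fbar
    obtain ⟨r, rfl⟩ := Submodule.Quotient.mk_surjective _ a
    obtain ⟨g, hg⟩ := exists_smul_eq_of_forall_mem hxW (f - r • LinearMap.id) (fun w => by
      rw [← quotSMulTop_mk_eq_zero_iff]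
      have := LinearMap.congr_fun ha (Submodule.Quotient.mk w)
      change r • (Submodule.Quotient.mk w : QuotSMulTop x W) = Submodule.Quotient.mk (f w) at this
      change (Submodule.Quotient.mk (f w - r • w) : QuotSMulTop x W) = 0
      rw [Submodule.Quotient.mk_sub, ← this, Submodule.Quotient.mk_smul, sub_self])
    have : f = r • LinearMap.id + x • g := by rw [hg]; abel
    rw [this]
    exact Submodule.add_mem_sup
      (Submodule.smul_mem _ _ (Submodule.mem_span_singleton_self _))
      (Submodule.smul_mem_smul hxm trivial)
  have htop := Submodule.le_of_le_smul_of_le_jacobson_bot (IsNoetherian.noetherian _)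
    (maximalIdeal_le_jacobson _) hle
  obtain ⟨r, hr⟩ := Submodule.mem_span_singleton.1 (htop (trivial : φ ∈ ⊤))
  exact ⟨r, fun w => by rw [← hr]; rfl⟩

end EndomorphismRing

/-! ### Multiplicities through a principal reduction -/

section Multiplicity

open scoped Pointwise nonZeroDivisors

section Length

variable {R : Type*} [CommRing R] {M : Type*} [AddCommGroup M] [Module R M]

/-- Additivity along `0 → M/N → M/aN → M/aM → 0`, the first map being multiplication by `a`. -/
theorem length_quotient_smul {a : R} (ha : IsSMulRegular M a) (N : Submodule R M) :
    Module.length R (M ⧸ a • N) = Module.length R (M ⧸ N) +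
      Module.length R (M ⧸ (a • ⊤ : Submodule R M)) := by
  have hle : a • N ≤ a • ⊤ := Submodule.map_mono le_top
  have hcomap : N ≤ (a • N).comap (LinearMap.lsmul R M a) :=
    fun n hn => Submodule.smul_mem_pointwise_smul n a N hn
  refine Module.length_eq_add_of_exact (Submodule.mapQ N (a • N) (LinearMap.lsmul R M a)
    hcomap) (Submodule.factor hle) ?_
    (Submodule.factor_surjective hle) ?_
  · rw [injective_iff_map_eq_zero]
    intro m hm
    obtain ⟨m, rfl⟩ := Submodule.Quotient.mk_surjective _ m
    rw [Submodule.mapQ_apply, Submodule.Quotient.mk_eq_zero,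
      Submodule.mem_smul_pointwise_iff_exists] at hm
    obtain ⟨n, hn, h⟩ := hm
    rw [Submodule.Quotient.mk_eq_zero, ← ha h]
    exact hn
  · intro m
    obtain ⟨m, rfl⟩ := Submodule.Quotient.mk_surjective _ m
    change (Submodule.Quotient.mk m : M ⧸ (a • ⊤ : Submodule R M)) = 0 ↔ _
    rw [Submodule.Quotient.mk_eq_zero, Submodule.mem_smul_pointwise_iff_exists]
    constructor
    · rintro ⟨n, -, rfl⟩
      exact ⟨Submodule.Quotient.mk n, rfl⟩
    · rintro ⟨n, hn⟩
      obtain ⟨n, rfl⟩ := Submodule.Quotient.mk_surjective _ n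
      rw [Submodule.mapQ_apply, Submodule.Quotient.eq,
        Submodule.mem_smul_pointwise_iff_exists] at hn
      obtain ⟨k, -, hk⟩ := hn
      refine ⟨n - k, trivial, ?_⟩
      rw [smul_sub, hk]
      simp

theorem length_quotient_eq_add {Q P : Submodule R M} (h : Q ≤ P) :
    Module.length R (M ⧸ Q) = Module.length R (P ⧸ Q.submoduleOf P) +
      Module.length R (M ⧸ P) := by
  have hcomap : Q.submoduleOf P ≤ Q.comap P.subtype := le_rfl
  refine Module.length_eq_add_of_exact (Submodule.mapQ (Q.submoduleOf P) Q P.subtype hcomap)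
    (Submodule.factor h) ?_ (Submodule.factor_surjective h) ?_
  · rw [injective_iff_map_eq_zero]
    intro m hm
    obtain ⟨m, rfl⟩ := Submodule.Quotient.mk_surjective _ m
    rw [Submodule.mapQ_apply, Submodule.Quotient.mk_eq_zero] at hm
    exact (Submodule.Quotient.mk_eq_zero _).2 hm
  · intro m
    obtain ⟨m, rfl⟩ := Submodule.Quotient.mk_surjective _ m
    change (Submodule.Quotient.mk m : M ⧸ P) = 0 ↔ _
    rw [Submodule.Quotient.mk_eq_zero]
    constructor
    · intro hm
      exact ⟨Submodule.Quotient.mk ⟨m, hm⟩, rfl⟩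
    · rintro ⟨n, hn⟩
      obtain ⟨n, rfl⟩ := Submodule.Quotient.mk_surjective _ n
      rw [Submodule.mapQ_apply, Submodule.Quotient.eq] at hn
      have := P.sub_mem n.2 (h hn)
      simpa using this

theorem eq_of_length_quotient_eq {Q P : Submodule R M} (h : Q ≤ P)
    (hfin : Module.length R (M ⧸ P) ≠ ⊤)
    (hl : Module.length R (M ⧸ Q) = Module.length R (M ⧸ P)) : Q = P := by
  refine le_antisymm h ?_
  rw [length_quotient_eq_add h] at hl
  have h0 : Module.length R (P ⧸ Q.submoduleOf P) = 0 := by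
    exact (WithTop.add_right_inj hfin).1 (hl.trans (zero_add _).symm)
  rw [Module.length_eq_zero_iff, Submodule.Quotient.subsingleton_iff] at h0
  exact Submodule.submoduleOf_eq_top.1 h0

theorem tendsto_length_div {f : ℕ → ℕ∞} {c d : ℕ} {r : ℕ} (h : ∀ n, f (n + r) = n * c + d) :
    Tendsto (fun n : ℕ => ((Nat.factorial 1 : ℕ) : ENNReal) * (f n : ENNReal) /
      (n : ENNReal) ^ 1) atTop (𝓝 ((c : ℕ∞) : ENNReal)) := by
  -- Shifting by `r + 1` rather than `r` keeps the denominator positive for every index.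
  rw [← tendsto_add_atTop_iff_nat (r + 1)]
  have hreal : Tendsto (fun n : ℕ => (c : ℝ) + (c + d - (r + 1) * c) / ((n + (r + 1) : ℕ) : ℝ)) atTop
      (𝓝 c) := by
    have := (tendsto_add_atTop_iff_nat (r + 1)).2
      (tendsto_const_div_atTop_nhds_zero_nat ((c : ℝ) + d - (r + 1) * c))
    simpa using this.const_add (c : ℝ)
  have := ENNReal.tendsto_ofReal hreal
  rw [ENNReal.ofReal_natCast] at this
  simp only [ENat.toENNReal_coe]
  refine this.congr fun n => ?_
  have hn : f (n + (r + 1)) = ((((n + 1) * c + d : ℕ) : ℕ) : ℕ∞) := by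
    rw [show n + (r + 1) = (n + 1) + r by ring, h]
    push_cast
    ring
  have hpos : (0 : ℝ) < ((n + (r + 1) : ℕ) : ℝ) := by positivity
  rw [hn, ENat.toENNReal_coe, pow_one, Nat.factorial_one, Nat.cast_one, one_mul,
    ← ENNReal.ofReal_natCast, ← ENNReal.ofReal_natCast, ← ENNReal.ofReal_div_of_pos hpos]
  congr 1
  rw [eq_div_iff hpos.ne', add_mul, div_mul_cancel₀ _ hpos.ne']
  push_cast
  ring

end Length

variable {R : Type u} [CommRing R] [IsNoetherianRing R] [Ring.KrullDimLE 1 R] {ω : Ideal R}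
  {a : R} {r : ℕ} (haR : a ∈ R⁰) (haω : a ∈ ω) (hred : ω ^ (r + 1) = Ideal.span {a} * ω ^ r)
  (M : Type u) [AddCommGroup M] [Module R M] [Module.Finite R M] [Module.IsTorsionFree R M]

omit [Module.IsTorsionFree R M] in
include haR in
theorem length_quotient_ne_top {N : Submodule R M} (hN : a • ⊤ ≤ N) :
    Module.length R (M ⧸ N) ≠ ⊤ := by
  rw [Module.length_ne_top_iff]
  refine isFiniteLength_of_smul_eq_zero (isFiniteLength_quotient_span_singleton R haR) _ ?_
  intro m
  obtain ⟨m, rfl⟩ := Submodule.Quotient.mk_surjective _ m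
  rw [← Submodule.Quotient.mk_smul, Submodule.Quotient.mk_eq_zero]
  exact hN (Submodule.smul_mem_pointwise_smul m a ⊤ trivial)

omit [IsNoetherianRing R] [Ring.KrullDimLE 1 R] [Module.Finite R M]
  [Module.IsTorsionFree R M] in
include haω in
theorem smul_le_ideal_smul (N : Submodule R M) : a • N ≤ ω • N := by
  rw [← Submodule.ideal_span_singleton_smul]
  exact Submodule.smul_mono_left ((Ideal.span_singleton_le_iff_mem ω).2 haω)

omit [IsNoetherianRing R] [Ring.KrullDimLE 1 R] [Module.Finite R M] in
include haR in
theorem isSMulRegular_of_mem_nonZeroDivisors : IsSMulRegular M a :=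
  (isRegular_iff_mem_nonZeroDivisors.2 haR).isSMulRegular

include haR haω hred in
-- From exponent `r` on, multiplying by `ω` amounts to multiplying by `a`, so `ℓ(M/ω ^ (n + r) M)`
-- is linear in `n` with slope `ℓ(M/aM)`; limits are unique.
theorem isHilbertSamuelMultiplicity_iff (e : ℕ∞) :
    IsHilbertSamuelMultiplicity 1 ω M e ↔
      e = Module.length R (M ⧸ (a • ⊤ : Submodule R M)) := by
  have hreg := isSMulRegular_of_mem_nonZeroDivisors haR M
  have hd : Module.length R (M ⧸ (ω ^ r • ⊤ : Submodule R M)) ≠ ⊤ :=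
    length_quotient_ne_top (pow_mem haR r) M (smul_le_ideal_smul (Ideal.pow_mem_pow haω r) M ⊤)
  obtain ⟨d, hd⟩ := ENat.ne_top_iff_exists.1 hd
  obtain ⟨c, hc⟩ := ENat.ne_top_iff_exists.1 (length_quotient_ne_top haR M le_rfl)
  have hlen : ∀ n : ℕ, Module.length R (M ⧸ (ω ^ (n + r) • ⊤ : Submodule R M)) = n * c + d := by
    intro n
    induction n with
    | zero => rw [zero_add, ← hd, Nat.cast_zero, zero_mul, zero_add]
    | succ n ih =>
      have hpow : ω ^ (n + 1 + r) = Ideal.span {a} * ω ^ (n + r) := by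
        rw [show n + 1 + r = (r + 1) + n by ring, pow_add, hred, mul_assoc, ← pow_add, add_comm r n]
      rw [hpow, mul_smul, Submodule.ideal_span_singleton_smul, length_quotient_smul hreg, ih, ← hc]
      push_cast
      ring
  have hlim := tendsto_length_div
    (f := fun n => Module.length R (M ⧸ (ω ^ n • ⊤ : Submodule R M))) hlen
  rw [← hc]
  constructor
  · intro h
    exact ENat.toENNReal_inj.1 (tendsto_nhds_unique h hlim)
  · rintro rfl
    exact hlim

include haR haω hred in
theorem isUlrich_iff [Nontrivial M] :
    IsUlrich ω M ↔ (ω • ⊤ : Submodule R M) = a • ⊤ := by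
  have hle := smul_le_ideal_smul haω M ⊤
  constructor
  · rintro ⟨-, -, -, h⟩
    rw [isHilbertSamuelMultiplicity_iff haR haω hred] at h
    exact (eq_of_length_quotient_eq hle (length_quotient_ne_top haR M hle) h.symm).symm
  · intro h
    refine ⟨inferInstance, inferInstance, inferInstance, ?_⟩
    rw [isHilbertSamuelMultiplicity_iff haR haω hred, h]

include haR haω hred in
theorem hasMinimalMultiplicity_iff [Nontrivial M] :
    HasMinimalMultiplicity ω M ↔ (ω ^ 2 • ⊤ : Submodule R M) = a • ω • (⊤ : Submodule R M) := by
  have hreg := isSMulRegular_of_mem_nonZeroDivisors haR M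
  have hle := smul_le_ideal_smul haω M ⊤
  have hle2 : a • ω • (⊤ : Submodule R M) ≤ ω ^ 2 • ⊤ := by
    rw [pow_two, mul_smul]
    exact smul_le_ideal_smul haω M _
  have hle3 : ω ^ 2 • (⊤ : Submodule R M) ≤ ω • ⊤ :=
    Submodule.smul_mono_left (Ideal.pow_le_self two_ne_zero)
  have hfin := length_quotient_ne_top haR M hle
  have hfin2 : Module.length R (M ⧸ (ω ^ 2 • ⊤ : Submodule R M)) ≠ ⊤ :=
    length_quotient_ne_top (pow_mem haR 2) M (smul_le_ideal_smul (Ideal.pow_mem_pow haω 2) M ⊤)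
  have hcancel (x y : ℕ∞) : x + Module.length R (M ⧸ (ω • ⊤ : Submodule R M)) =
      y + Module.length R (M ⧸ (ω • ⊤ : Submodule R M)) ↔ x = y := WithTop.add_right_inj hfin
  have key : Module.length R (↥(ω • ⊤ : Submodule R M) ⧸
      (ω ^ 2 • ⊤ : Submodule R M).submoduleOf (ω • ⊤ : Submodule R M)) =
      Module.length R (M ⧸ (a • ⊤ : Submodule R M)) ↔
      (ω ^ 2 • ⊤ : Submodule R M) = a • ω • (⊤ : Submodule R M) := by
    -- Adding the finite length `ℓ(M/ωM)` to both sides turns the condition into `ℓ(M/ω²M) =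
    -- ℓ(M/aωM)`, where `aωM ⊆ ω²M`.
    rw [← hcancel, ← length_quotient_eq_add hle3, add_comm,
      ← length_quotient_smul hreg]
    constructor
    · intro h
      exact (eq_of_length_quotient_eq hle2 hfin2 h.symm).symm
    · intro h
      rw [h]
  rw [← key, ← isHilbertSamuelMultiplicity_iff haR haω hred]
  exact ⟨fun h => h.multiplicity_eq, fun h => ⟨inferInstance, inferInstance, inferInstance, h⟩⟩

end Multiplicity

/-! ### Canonical ideals in dimension one -/

section CanonicalIdeal

open scoped nonZeroDivisors Pointwise

variable {R : Type u} [CommRing R]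

theorem exists_mem_maximalIdeal_mem_nonZeroDivisors [IsLocalRing R] (hdim : ringKrullDim R = 1)
    (hCM : IsCohenMacaulayLocalRing R) : ∃ x ∈ maximalIdeal R, x ∈ R⁰ := by
  obtain ⟨-, rs, hmem, hreg, hlen⟩ := hCM
  rw [hdim] at hlen
  match rs, hmem, hreg, hlen with
  | [], _, _, hlen => simp at hlen
  | x :: l, hmem, hreg, _ =>
    have hx := ((RingTheory.Sequence.isRegular_cons_iff R x l).1 hreg).1
    exact ⟨x, hmem x (by simp), mem_nonZeroDivisors_iff_right.2 fun y hy => hx (by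
      simpa [mul_comm] using hy)⟩

/-- The endomorphism ring of a canonical ideal in dimension one is `R`, and the ideal is
faithful. -/
theorem IsCanonicalIdeal.faithful_and_endomorphism [IsNoetherianRing R] [IsLocalRing R]
    (hdim : ringKrullDim R = 1) (hCM : IsCohenMacaulayLocalRing R) {ω : Ideal R}
    (hω : IsCanonicalIdeal ω) :
    (∀ r : R, (∀ w : ω, r • w = 0) → r = 0) ∧
      ∀ φ : ω →ₗ[R] ω, ∃ r : R, ∀ w, φ w = r • w := by
  obtain ⟨x, hxm, hx⟩ := exists_mem_maximalIdeal_mem_nonZeroDivisors hdim hCM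
  have : Ring.KrullDimLE 1 R := (Order.krullDimLE_iff _ _).2 hdim.le
  have hnt : Nontrivial ω := by
    obtain ⟨rs, -, hreg, -⟩ := hω.maximalCohenMacaulay.exists_regular
    exact hreg.nontrivial
  have hxR := isSMulRegular_of_mem_nonZeroDivisors hx R
  have hxω := isSMulRegular_of_mem_nonZeroDivisors hx ω
  have hfl := isFiniteLength_quotient_span_singleton R hx
  have hinj := hω.finite_injDim
  obtain ⟨d, hd, hext⟩ := hω.type_one
  obtain rfl : d = 1 := by
    rw [hdim] at hd
    exact_mod_cast hd.symm
  exact ⟨fun r => eq_zero_of_forall_smul_eq_zero hxm hxR hxω hfl hinj,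
    exists_forall_apply_eq_smul hxm hxR hxω hfl hinj
      (length_hom_residueField_le_one hxω hxm hext)⟩

theorem exists_mem_nonZeroDivisors_of_faithful [IsNoetherianRing R] {ω : Ideal R}
    (h : ∀ r : R, (∀ w : ω, r • w = 0) → r = 0) : ∃ y ∈ ω, y ∈ R⁰ := by
  have : FaithfulSMul R ω := ⟨fun {r s} hrs => sub_eq_zero.1 (h _ fun w => by
    rw [sub_smul, hrs, sub_self])⟩
  obtain ⟨y, hy, hyR⟩ := Ideal.nonempty_inter_nonZeroDivisors_of_faithfulSMul (I := ω)
  exact ⟨y, hy, hyR⟩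

/-- For a prime `p` containing `J`, the domain `R/p` is a quotient of the finite length module
`R/y`, hence an Artinian domain, hence a field. So `𝔪` is the only prime over `J`. -/
theorem isMaximalPrimary_of_mem_nonZeroDivisors [IsNoetherianRing R] [IsLocalRing R]
    [Ring.KrullDimLE 1 R] {J : Ideal R} (hJ : J ≠ ⊤) {y : R} (hy : y ∈ J) (hyR : y ∈ R⁰) :
    IsMaximalPrimary J := by
  have hrad : J.radical = maximalIdeal R := by
    refine le_antisymm ((maximalIdeal.isMaximal R).isPrime.radical_le_iff.2
      (le_maximalIdeal hJ)) ?_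
    rw [Ideal.radical_eq_sInf]
    refine le_sInf fun p ⟨hJp, hp⟩ => ?_
    have hfl := isFiniteLength_quotient_span_singleton R hyR
    have hA : IsArtinianRing (R ⧸ p) := by
      have h1 : IsArtinian R (R ⧸ Ideal.span {y}) := (isFiniteLength_iff_isNoetherian_isArtinian.1
        hfl).2
      have h2 : IsArtinian R (R ⧸ p) := isArtinian_of_surjective _ (Submodule.factor
        ((Ideal.span_singleton_le_iff_mem p).2 (hJp hy))) (Submodule.factor_surjective _)
      exact isArtinian_of_tower R h2
    have : p.IsMaximal := Ideal.Quotient.maximal_of_isField p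
      (IsArtinianRing.isField_of_isDomain _)
    exact (IsLocalRing.eq_maximalIdeal this).ge
  exact ⟨Ideal.isPrimary_of_isMaximal_radical (hrad ▸ maximalIdeal.isMaximal R), hrad⟩

/-- The regular element `y ^ (n + 1)` is a multiple of `a`, so `a` is regular. -/
theorem mem_nonZeroDivisors_of_isReduction {a y : R} {ω : Ideal R} {n : ℕ} (hy : y ∈ ω)
    (hyR : y ∈ R⁰) (h : ω ^ (n + 1) = Ideal.span {a} * ω ^ n) : a ∈ R⁰ := by
  have h1 : y ^ (n + 1) ∈ Ideal.span {a} := by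
    refine Ideal.mul_le_left (J := ω ^ n) ?_
    rw [← h]
    exact Ideal.pow_mem_pow hy _
  obtain ⟨b, hb⟩ := Ideal.mem_span_singleton'.1 h1
  have h2 : b * a ∈ R⁰ := by
    rw [hb]
    exact pow_mem hyR (n + 1)
  exact (mul_mem_nonZeroDivisors.1 h2).2

end CanonicalIdeal

/-! ### The dual of an ideal and trace ideals -/

section Dual

open scoped nonZeroDivisors Pointwise

variable {R : Type u} [CommRing R] {ω I : Ideal R} {a : R}

/-- If `End(ω) = R` and `ω²I = aωI`, then `ω Hom(I, R) = a Hom(I, R)`. -/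
theorem ideal_smul_dual_eq (haR : a ∈ R⁰) (haω : a ∈ ω)
    (hfaith : ∀ r : R, (∀ w : ω, r • w = 0) → r = 0)
    (hend : ∀ φ : ω →ₗ[R] ω, ∃ r : R, ∀ w, φ w = r • w)
    (h : (ω ^ 2 • ⊤ : Submodule R I) = a • ω • (⊤ : Submodule R I)) :
    (ω • ⊤ : Submodule R (Module.Dual R I)) = a • ⊤ := by
  refine le_antisymm (Submodule.smul_le.2 fun w hw f _ => ?_) (smul_le_ideal_smul haω _ _)
  have hreg := isSMulRegular_of_mem_nonZeroDivisors haR R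
  have hdvd : ∀ i : I, ∃ b : R, a • b = (w • f) i := by
    intro i
    -- Here `w f(i) v = f(w v i)` with `w v i ∈ ω²I = aωI`, and `f` maps `ωI` into `ω`.
    have hmul : ∀ v : ω, ∃ u : ω, a • u = (w * f i) • v := by
      intro v
      have h1 : (w * v.1) • i ∈ a • ω • (⊤ : Submodule R I) := by
        rw [← h, pow_two]
        exact Submodule.smul_mem_smul (Ideal.mul_mem_mul hw v.2) trivial
      obtain ⟨j, hj, hji⟩ := Submodule.mem_smul_pointwise_iff_exists _ _ _ |>.1 h1
      have hfj : f j ∈ ω := by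
        refine Submodule.smul_induction_on hj (fun s hs k _ => ?_) fun k l hk hl => ?_
        · rw [map_smul, smul_eq_mul]
          exact Ideal.mul_mem_right _ _ hs
        · rw [map_add]
          exact ω.add_mem hk hl
      refine ⟨⟨f j, hfj⟩, Subtype.ext ?_⟩
      change a * f j = w * f i * v
      rw [← smul_eq_mul, ← map_smul, hji, map_smul, smul_eq_mul]
      ring
    -- `φ` plays the role of the fraction `w f(i)/a`; `hend` puts it in `R`, and faithfulness of `ω`
    -- gives `a b = w f(i)`.
    obtain ⟨φ, hφ⟩ := exists_smul_eq_of_forall_mem (isSMulRegular_of_mem_nonZeroDivisors haR ω)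
      (LinearMap.lsmul R ω (w * f i)) hmul
    obtain ⟨b, hb⟩ := hend φ
    refine ⟨b, sub_eq_zero.1 (hfaith _ fun v => ?_)⟩
    have := LinearMap.congr_fun hφ v
    change a • φ v = (w * f i) • v at this
    rw [sub_smul, LinearMap.smul_apply, smul_eq_mul, smul_eq_mul, ← this, hb, mul_smul, sub_self]
  obtain ⟨g, hg⟩ := exists_smul_eq_of_forall_mem hreg (w • f) hdvd
  rw [← hg]
  exact Submodule.smul_mem_pointwise_smul g a ⊤ trivial

/-- A trace ideal is stable under all its linear forms. -/
theorem IsTraceIdeal.apply_mem (hI : IsTraceIdeal I) (f : Module.Dual R I) (i : I) :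
    f i ∈ I := by
  obtain ⟨M, _, _, -, rfl⟩ := hI
  have hle : ∀ g : Module.Dual R M, LinearMap.range g ≤ trace R M :=
    fun g => le_iSup (fun g : Module.Dual R M => LinearMap.range g) g
  -- It suffices to test `f` on the generators `g m`, and `f (g m)` is a value of the linear form `f
  -- ∘ g` on `M`.
  have hmap : trace R M ≤ (Submodule.comap f (trace R M)).map (trace R M).subtype := by
    refine iSup_le fun g => ?_
    rintro _ ⟨m, rfl⟩
    refine ⟨⟨g m, hle g ⟨m, rfl⟩⟩, ?_, rfl⟩
    exact hle (f ∘ₗ g.codRestrict (trace R M) fun m => hle g ⟨m, rfl⟩) ⟨m, rfl⟩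
  obtain ⟨j, hj, hji⟩ := hmap i.2
  obtain rfl : j = i := Subtype.ext hji
  exact hj

theorem IsTraceIdeal.ideal_smul_eq (hI : IsTraceIdeal I) (haω : a ∈ ω)
    (h : (ω • ⊤ : Submodule R (Module.Dual R I)) = a • ⊤) :
    (ω • ⊤ : Submodule R I) = a • ⊤ := by
  refine le_antisymm (Submodule.smul_le.2 fun w hw i _ => ?_) (smul_le_ideal_smul haω _ _)
  -- The hypothesis is needed only for the inclusion `I → R`.
  have h1 : w • (I.subtype : Module.Dual R I) ∈ (a • ⊤ : Submodule R (Module.Dual R I)) :=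
    h ▸ Submodule.smul_mem_smul hw trivial
  obtain ⟨g, -, hg⟩ := Submodule.mem_smul_pointwise_iff_exists _ _ _ |>.1 h1
  have : w • i = a • (⟨g i, hI.apply_mem g i⟩ : I) := Subtype.ext (LinearMap.congr_fun hg i).symm
  rw [this]
  exact Submodule.smul_mem_pointwise_smul _ a ⊤ trivial

theorem nontrivial_dual_ideal [Nontrivial I] : Nontrivial (Module.Dual R I) := by
  obtain ⟨i, hi⟩ := exists_ne (0 : I)
  exact ⟨I.subtype, 0, fun h => hi (Subtype.ext (LinearMap.congr_fun h i))⟩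

end Dual

end LocalAlg

theorem mainTheorem3 (R : Type u) [CommRing R] [IsNoetherianRing R] [IsLocalRing R]
    (hdim : ringKrullDim R = 1)
    (hCM : LocalAlg.IsCohenMacaulayLocalRing R)
    (hred : ∀ J : Ideal R, LocalAlg.IsMaximalPrimary J →
      ∃ x : R, LocalAlg.IsMinimalReduction (Ideal.span {x}) J)
    (hgen : LocalAlg.IsGenericallyGorenstein R)
    (hnG : ¬ LocalAlg.IsGorensteinLocalRing R)
    (ω : Ideal R) (hω : LocalAlg.IsCanonicalIdeal ω)
    (I : Ideal R) (hI : LocalAlg.IsMaximalPrimary I) :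
    (LocalAlg.HasMinimalMultiplicity ω I → LocalAlg.IsUlrich ω (Module.Dual R I)) ∧
    (LocalAlg.IsTraceIdeal I →
      (LocalAlg.IsUlrich ω (Module.Dual R I) → LocalAlg.IsUlrich ω I) ∧
      (LocalAlg.HasMinimalMultiplicity ω I ↔ LocalAlg.IsUlrich ω I)) := by
  have : Ring.KrullDimLE 1 R := (Order.krullDimLE_iff _ _).2 hdim.le
  obtain ⟨hfaith, hend⟩ := hω.faithful_and_endomorphism hdim hCM
  obtain ⟨y, hy, hyR⟩ := LocalAlg.exists_mem_nonZeroDivisors_of_faithful hfaith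
  obtain ⟨a, haω, n, hn⟩ : ∃ a ∈ ω, ∃ n : ℕ, ω ^ (n + 1) = Ideal.span {a} * ω ^ n := by
    -- The unit ideal is not `𝔪`-primary, so `hred` does not cover it; there `a = 1` and exponent
    -- `0` serve.
    by_cases htop : ω = ⊤
    · exact ⟨1, htop ▸ trivial, 0, by simp [htop]⟩
    · obtain ⟨a, ⟨hle, n, hn⟩, -⟩ :=
        hred ω (LocalAlg.isMaximalPrimary_of_mem_nonZeroDivisors htop hy hyR)
      exact ⟨a, (Ideal.span_singleton_le_iff_mem ω).1 hle, n, hn⟩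
  have haR := LocalAlg.mem_nonZeroDivisors_of_isReduction hy hyR hn
  have hdual : LocalAlg.HasMinimalMultiplicity ω I → LocalAlg.IsUlrich ω (Module.Dual R I) := by
    intro h
    have := h.nontrivial
    have := LocalAlg.nontrivial_dual_ideal (I := I)
    rw [LocalAlg.isUlrich_iff haR haω hn]
    exact LocalAlg.ideal_smul_dual_eq haR haω hfaith hend
      ((LocalAlg.hasMinimalMultiplicity_iff haR haω hn I).1 h)
  have htrace : LocalAlg.IsTraceIdeal I → LocalAlg.IsUlrich ω (Module.Dual R I) →
      LocalAlg.IsUlrich ω I := by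
    intro hI h
    have := h.nontrivial
    have : Nontrivial I := by
      rw [← not_subsingleton_iff_nontrivial]
      intro _
      exact not_subsingleton (Module.Dual R I) inferInstance
    rw [LocalAlg.isUlrich_iff haR haω hn] at h ⊢
    exact hI.ideal_smul_eq haω h
  refine ⟨hdual, fun hI => ⟨htrace hI, fun h => htrace hI (hdual h), fun h => ?_⟩⟩
  have := h.nontrivial
  rw [LocalAlg.isUlrich_iff haR haω hn] at h
  -- Both sides reduce to `a²I`: `ω(ωI) = ω(aI) = a(ωI)`, and `ωI = aI`.
  rw [LocalAlg.hasMinimalMultiplicity_iff haR haω hn, pow_two, mul_smul, h,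
    ← Submodule.ideal_span_singleton_smul, ← Submodule.ideal_span_singleton_smul, ← mul_smul,
    mul_comm, mul_smul, h]
  simp only [Submodule.ideal_span_singleton_smul]
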